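/- There exist absolute constants $C,D>0$ such that the following holds. Let $\ell,u\ge 0$ be integers, let $n=2^\ell$, let $S\subseteq\mathbb F_2^u$ be a nonempty set of size $m$, and let $\lambda=m/n$. Let $t>0$ be the real number defined by \[ t\ln\left(\frac{t}{e\lambda}\right)=\ln n . \] Let $h:\mathbb F_2^u\to\mathbb F_2^\ell$ be a uniformly random linear map, and let $\mathsf M(S,h)=\max_{y\in\mathbb F_2^\ell}|h^{-1}(y)\cap S|$ be its maximum load on $S$. Then, for every real $R>1$ satisfying \[ R\left(\frac{t}{\lambda}\right)^{1-1/R}\ge D, \] one has \[ \Pr_h\left[\mathsf M(S,h)\ge Rt\right]\le\frac{C}{R^2}\left(\frac{\lambda}{t}\right)^{2-2/R}. \] -/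

import Mathlib

/-- The space of all linear maps from `𝔽₂ᵘ` to `𝔽₂ˡ`. -/
abbrev BinaryLinearMap (u l : ℕ) : Type :=
  (Fin u → ZMod 2) →ₗ[ZMod 2] (Fin l → ZMod 2)

noncomputable instance BinaryLinearMap.instFintype (u l : ℕ) : Fintype (BinaryLinearMap u l) :=
  @Fintype.ofFinite _ (Finite.of_injective (fun h : BinaryLinearMap u l => (h : _ → _))
    DFunLike.coe_injective)

/-- The load of the bin `y`: the number of keys `x ∈ S` with `h x = y`. -/
def binLoad {u l : ℕ} (S : Finset (Fin u → ZMod 2)) (h : BinaryLinearMap u l)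
    (y : Fin l → ZMod 2) : ℕ :=
  (S.filter fun x => h x = y).card

/-- The maximum load over all bins `y ∈ 𝔽₂ˡ` (a maximum over a finite nonempty set). -/
def maxLoad {u l : ℕ} (S : Finset (Fin u → ZMod 2)) (h : BinaryLinearMap u l) : ℕ :=
  Finset.univ.sup fun y : Fin l → ZMod 2 => binLoad S h y

/-- The probability that a uniformly random linear map `𝔽₂ᵘ → 𝔽₂ˡ` lies in `A`. -/
noncomputable def randomMapProb (u l : ℕ) (A : Set (BinaryLinearMap u l)) : ℝ :=
  ((PMF.uniformOfFintype (BinaryLinearMap u l)).toOuterMeasure A).toReal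

open Finset
open scoped BigOperators

/-! A uniform map to `𝔽₂ˡ` is a uniform map to a much larger space followed by contractions, each
losing one dimension along a random direction. Let `d` be the average over bins of `b ^ load - 1`. A
contraction merges bins in pairs and turns `d` into `2 * d + Z`, where `Z ≥ 0` has mean at most `d ^
2` (`expect_truncatedRatio_contract_le`). A truncated quadratic potential in `d`, at scales
following the same recursion, therefore does not increase on average (`expect_truncatedRatio_le`).
In very high dimension the map is almost surely injective on `S`, so `d` is explicit and the
potential is of order `((b - 1) * #S / s) ^ 2`. In dimension `l`, Markov's inequality bounds the
chance that `d` reaches the scale, which one bin of load `R * t` forces for a suitable `b`. -/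

/-! ### The truncated potential -/

/-- A bounded potential, comparable to `min 1 (d / η) ^ 2` for `d` of order `η`. -/
noncomputable def truncatedRatio (η d : ℝ) : ℝ := min (1 / 2) (d ^ 2 / (η * (η + d)))

lemma truncatedRatio_eq_half {η d : ℝ} (hη : 0 < η) (h : η ≤ d) : truncatedRatio η d = 1 / 2 := by
  refine min_eq_left ?_
  rw [le_div_iff₀ (by nlinarith)]
  nlinarith

lemma truncatedRatio_nonneg {η d : ℝ} (hη : 0 < η) (hd : 0 ≤ d) : 0 ≤ truncatedRatio η d :=
  le_min (by norm_num) (by positivity)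

lemma truncatedRatio_le_half (η d : ℝ) : truncatedRatio η d ≤ 1 / 2 := min_le_left _ _

lemma truncatedRatio_le_sq {η d : ℝ} (hη : 0 < η) (hd : 0 ≤ d) :
    truncatedRatio η d ≤ (d / η) ^ 2 := by
  refine (min_le_right _ _).trans ?_
  rw [div_pow]
  exact div_le_div_of_nonneg_left (by positivity) (by positivity) (by nlinarith)

/-- Since `x ^ 2 / (η + x) = x - η + η ^ 2 / (η + x)` and the last term decreases in `x ≥ 0`, the
growth rate is at most 1. -/
lemma sq_div_add_le {η d z : ℝ} (hη : 0 < η) (hd : 0 ≤ d) (hz : 0 ≤ z) :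
    (d + z) ^ 2 / (η + (d + z)) ≤ d ^ 2 / (η + d) + z := by
  have h1 : 0 < η + d := by positivity
  have h2 : 0 < η + (d + z) := by positivity
  rw [div_add' _ _ _ h1.ne', div_le_div_iff₀ h2 h1]
  have : 0 ≤ z * (η * η) := by positivity
  have : 0 ≤ z * (η * z) := by positivity
  nlinarith [mul_nonneg hz (mul_nonneg hd hη.le), mul_nonneg hz (mul_nonneg hd hz)]

/-- The potential does not increase on average when `d` is replaced by `2 * d + Z`, with `Z ≥ 0` of
mean at most `d ^ 2`, provided the scale `η` moves to `2 * η + 2 * η ^ 2`. -/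
lemma expect_truncatedRatio_le {ι : Type*} [Fintype ι] [Nonempty ι] {η d : ℝ} (hη : 0 < η)
    (hd : 0 ≤ d) (Z : ι → ℝ) (hZ : ∀ w, 0 ≤ Z w) (hE : 𝔼 w, Z w ≤ d ^ 2) :
    𝔼 w, truncatedRatio (2 * η + 2 * η ^ 2) (2 * d + Z w) ≤ truncatedRatio η d := by
  rcases le_total η d with h | h
  · rw [truncatedRatio_eq_half hη h]
    calc _ ≤ 𝔼 _w : ι, (1 / 2 : ℝ) := expect_le_expect fun w _ => truncatedRatio_le_half _ _
      _ = _ := Fintype.expect_const _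
  set η' := 2 * η + 2 * η ^ 2 with hη'
  have hη'0 : 0 < η' := by positivity
  have key : ∀ w, truncatedRatio η' (2 * d + Z w) ≤
      ((2 * d) ^ 2 / (η' + 2 * d) + Z w) * η'⁻¹ := by
    intro w
    refine (min_le_right _ _).trans ?_
    rw [mul_comm η', ← div_div, div_eq_mul_inv _ η']
    exact mul_le_mul_of_nonneg_right (sq_div_add_le hη'0 (by positivity) (hZ w)) (by positivity)
  have avg : 𝔼 w, truncatedRatio η' (2 * d + Z w) ≤
      ((2 * d) ^ 2 / (η' + 2 * d) + d ^ 2) * η'⁻¹ := by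
    calc _ ≤ 𝔼 w, ((2 * d) ^ 2 / (η' + 2 * d) + Z w) * η'⁻¹ := expect_le_expect fun w _ => key w
      _ = ((2 * d) ^ 2 / (η' + 2 * d) + 𝔼 w, Z w) * η'⁻¹ := by
        rw [← expect_mul, expect_add_distrib, Fintype.expect_const]
      _ ≤ _ := by gcongr
  have hden : 0 < η + d := by positivity
  have h2 : (2 * d) ^ 2 / (η' + 2 * d) ≤ 2 * d ^ 2 / (η + d) := by
    rw [div_le_div_iff₀ (by positivity) hden]
    have : 0 ≤ d ^ 2 * η ^ 2 := by positivity
    rw [hη']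
    nlinarith
  refine le_min ?_ (avg.trans ?_)
  · calc _ ≤ 𝔼 _w : ι, (1 / 2 : ℝ) := expect_le_expect fun w _ => truncatedRatio_le_half _ _
      _ = _ := Fintype.expect_const _
  calc ((2 * d) ^ 2 / (η' + 2 * d) + d ^ 2) * η'⁻¹
      ≤ (2 * d ^ 2 / (η + d) + d ^ 2) * η'⁻¹ := by gcongr
    _ = d ^ 2 * (2 + η + d) / ((η + d) * η') := by field_simp; ring
    -- After cancellation this is `(2 + η + d) * η ≤ 2 * η + 2 * η ^ 2`, that is `d ≤ η`: the reason
    -- for the quadratic term in the new scale.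
    _ ≤ d ^ 2 / (η * (η + d)) := by
        rw [div_le_div_iff₀ (by positivity) (by positivity)]
        have : 0 ≤ d ^ 2 * (η + d) * η * (η - d) :=
          mul_nonneg (by positivity) (by linarith)
        rw [hη']
        nlinarith

/-! ### Uniform averages and contraction by one dimension -/

/-- A surjective additive homomorphism of finite groups transports the uniform average. -/
lemma expect_comp_addMonoidHom {G G' : Type*} [AddGroup G] [AddGroup G'] [Fintype G] [Fintype G']
    (φ : G →+ G') (hφ : Function.Surjective φ) (f : G' → ℝ) :
    𝔼 g, f (φ g) = 𝔼 y, f y := by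
  classical
  set c := #{g | φ g = 0} with hc
  have hfib : ∀ y, #{g | φ g = y} = c := fun y =>
    AddMonoidHom.card_fiber_eq_of_mem_range φ (hφ y) (hφ 0)
  have hsum : ∀ f : G' → ℝ, ∑ g, f (φ g) = c * ∑ y, f y := by
    intro f
    rw [← sum_fiberwise univ φ, mul_sum]
    refine sum_congr rfl fun y _ => ?_
    rw [← hfib y, ← nsmul_eq_mul, ← sum_const]
    exact sum_congr rfl fun g hg => by rw [(mem_filter.1 hg).2]
  have hcard : (Fintype.card G : ℝ) = c * Fintype.card G' := by
    simpa using hsum fun _ => 1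
  have hG : (Fintype.card G : ℝ) ≠ 0 := by exact_mod_cast Fintype.card_ne_zero
  have hc0 : (c : ℝ) ≠ 0 := fun h => hG (by rw [hcard, h, zero_mul])
  rw [Fintype.expect_eq_sum_div_card, Fintype.expect_eq_sum_div_card, hsum, hcard,
    mul_div_mul_left _ _ hc0]

/-- The map `𝔽₂ᵏ⁺¹ → 𝔽₂ᵏ` that sends the first basis vector to `w` and the others to the
standard basis. -/
def contract {k : ℕ} (w : Fin k → ZMod 2) : (Fin (k + 1) → ZMod 2) →ₗ[ZMod 2] (Fin k → ZMod 2) where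
  toFun z := Fin.tail z + z 0 • w
  map_add' a b := by ext i; simp [Fin.tail]; ring
  map_smul' a b := by ext i; simp [Fin.tail]; ring

lemma contract_cons {k : ℕ} (w : Fin k → ZMod 2) (a : ZMod 2) (y : Fin k → ZMod 2) :
    contract w (Fin.cons a y : Fin (k + 1) → ZMod 2) = y + a • w := by
  simp [contract]

lemma contract_eq_iff {k : ℕ} (w y : Fin k → ZMod 2) (z : Fin (k + 1) → ZMod 2) :
    contract w z = y ↔ z = (Fin.cons 0 y : Fin (k + 1) → ZMod 2) ∨
      z = (Fin.cons 1 (y - w) : Fin (k + 1) → ZMod 2) := by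
  rw [← Fin.cons_self_tail z, contract_cons]
  generalize Fin.tail z = v
  generalize z 0 = a
  simp only [Fin.cons_inj]
  have h2 : ∀ a : ZMod 2, a = 0 ∨ a = 1 := by decide
  rcases h2 a with rfl | rfl
  · simp
  · simp [eq_sub_iff_add_eq]

/-- Postcomposition with `contract w` is a homomorphism of map spaces, surjective because `y ↦ (0,
y)` is a section of `contract w`; so it preserves uniformity for each fixed `w`. -/
lemma expect_contract_comp {u k : ℕ} (w : Fin k → ZMod 2) (f : BinaryLinearMap u k → ℝ) :
    𝔼 H : BinaryLinearMap u (k + 1), f (contract w ∘ₗ H) = 𝔼 h, f h := by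
  let φ : BinaryLinearMap u (k + 1) →+ BinaryLinearMap u k :=
    { toFun := fun H => contract w ∘ₗ H
      map_zero' := LinearMap.comp_zero _
      map_add' := fun a b => LinearMap.comp_add _ _ _ }
  refine expect_comp_addMonoidHom φ (fun h => ?_) f
  refine ⟨LinearMap.comp
    { toFun := fun y => (Fin.cons 0 y : Fin (k + 1) → ZMod 2)
      map_add' := fun a b => by ext i; refine Fin.cases ?_ (fun j => ?_) i <;> simp
      map_smul' := fun a b => by ext i; refine Fin.cases ?_ (fun j => ?_) i <;> simp } h, ?_⟩
  ext x : 2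
  change contract w (Fin.cons 0 _ : Fin (k + 1) → ZMod 2) = _
  rw [contract_cons]
  simp

lemma expect_fin_succ {k : ℕ} (g : (Fin (k + 1) → ZMod 2) → ℝ) :
    𝔼 z, g z = ((𝔼 y, g (Fin.cons 0 y)) + 𝔼 y, g (Fin.cons 1 y)) / 2 := by
  rw [← Fintype.expect_equiv (Fin.consEquiv fun _ : Fin (k + 1) => ZMod 2)
    (fun p => g (Fin.cons p.1 p.2)) g (fun p => rfl)]
  rw [← univ_product_univ, expect_product, Fintype.expect_eq_sum_div_card]
  congr 1
  exact Fin.sum_univ_two (fun i : Fin 2 => 𝔼 y, g (Fin.cons (i : ZMod 2) y))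

/-! ### Mean excess under contraction -/

section Excess

variable {u : ℕ} (S : Finset (Fin u → ZMod 2)) (b : ℝ)

/-- The average of `b ^ (load) - 1` over all bins. -/
noncomputable def meanExcess {k : ℕ} (h : BinaryLinearMap u k) : ℝ :=
  𝔼 y, (b ^ binLoad S h y - 1)

variable {b}

lemma excess_nonneg (hb : 1 ≤ b) (n : ℕ) : 0 ≤ b ^ n - 1 := sub_nonneg.2 (one_le_pow₀ hb)

lemma meanExcess_nonneg (hb : 1 ≤ b) {k : ℕ} (h : BinaryLinearMap u k) : 0 ≤ meanExcess S b h :=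
  expect_nonneg fun _ _ => excess_nonneg hb _

lemma binLoad_contract_comp {k : ℕ} (H : BinaryLinearMap u (k + 1)) (w y : Fin k → ZMod 2) :
    binLoad S (contract w ∘ₗ H) y =
      binLoad S H (Fin.cons 0 y) + binLoad S H (Fin.cons 1 (y - w)) := by
  unfold binLoad
  rw [← card_union_of_disjoint, ← filter_or]
  · congr 1
    ext x
    simp [contract_eq_iff]
  · refine disjoint_filter.2 fun x _ h0 h1 => ?_
    rw [h0] at h1
    simpa using congr_fun h1 0

lemma expect_sub_right {k : ℕ} (y : Fin k → ZMod 2) (f : (Fin k → ZMod 2) → ℝ) :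
    𝔼 w, f (y - w) = 𝔼 w, f w :=
  Fintype.expect_equiv (Equiv.subLeft y) _ _ fun _ => rfl

lemma expect_sub_left {k : ℕ} (w : Fin k → ZMod 2) (f : (Fin k → ZMod 2) → ℝ) :
    𝔼 y, f (y - w) = 𝔼 y, f y :=
  Fintype.expect_equiv (Equiv.subRight w) _ _ fun _ => rfl

/-- Merging bins with excesses `p` and `q` gives `(1 + p) * (1 + q) - 1 = p + q + p * q`. The linear
part averages to `2 * d`. Over random `w` the two factors of the product decouple, and AM-GM bounds
the product of the two half-space means by `d ^ 2`. -/
lemma expect_truncatedRatio_contract_le (hb : 1 ≤ b) {η : ℝ} (hη : 0 < η) {k : ℕ}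
    (H : BinaryLinearMap u (k + 1)) :
    𝔼 w, truncatedRatio (2 * η + 2 * η ^ 2) (meanExcess S b (contract w ∘ₗ H)) ≤
      truncatedRatio η (meanExcess S b H) := by
  set g : (Fin (k + 1) → ZMod 2) → ℝ := fun z => b ^ binLoad S H z - 1 with hg
  have hg0 : ∀ z, 0 ≤ g z := fun z => excess_nonneg hb _
  set Z : (Fin k → ZMod 2) → ℝ := fun w => 𝔼 y, g (Fin.cons 0 y) * g (Fin.cons 1 (y - w))
    with hZ
  have hmean : meanExcess S b H = ((𝔼 y, g (Fin.cons 0 y)) + 𝔼 y, g (Fin.cons 1 y)) / 2 :=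
    expect_fin_succ g
  have hstep : ∀ w, meanExcess S b (contract w ∘ₗ H) = 2 * meanExcess S b H + Z w := by
    intro w
    have h1 : ∀ y, b ^ binLoad S (contract w ∘ₗ H) y - 1 =
        g (Fin.cons 0 y) + g (Fin.cons 1 (y - w)) + g (Fin.cons 0 y) * g (Fin.cons 1 (y - w)) := by
      intro y
      rw [binLoad_contract_comp, pow_add]
      simp only [hg]
      ring
    rw [meanExcess, expect_congr rfl fun y _ => h1 y, expect_add_distrib, expect_add_distrib,
      expect_sub_left w (fun y => g (Fin.cons 1 y)), hmean]
    ring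
  simp only [hstep]
  refine expect_truncatedRatio_le hη (meanExcess_nonneg S hb H) Z
    (fun w => expect_nonneg fun y _ => mul_nonneg (hg0 _) (hg0 _)) ?_
  have : 𝔼 w, Z w = (𝔼 y, g (Fin.cons 0 y)) * 𝔼 y, g (Fin.cons 1 y) := by
    simp only [hZ]
    rw [expect_comm, expect_mul]
    refine expect_congr rfl fun y _ => ?_
    rw [← mul_expect, expect_sub_right y (fun v => g (Fin.cons 1 v))]
  rw [this, hmean]
  nlinarith [sq_nonneg ((𝔼 y, g (Fin.cons 0 y)) - 𝔼 y, g (Fin.cons 1 y))]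

lemma expect_truncatedRatio_le_succ (hb : 1 ≤ b) {η : ℝ} (hη : 0 < η) (k : ℕ) :
    𝔼 h : BinaryLinearMap u k, truncatedRatio (2 * η + 2 * η ^ 2) (meanExcess S b h) ≤
      𝔼 H : BinaryLinearMap u (k + 1), truncatedRatio η (meanExcess S b H) := by
  calc _ = 𝔼 w : Fin k → ZMod 2, 𝔼 H : BinaryLinearMap u (k + 1),
        truncatedRatio (2 * η + 2 * η ^ 2) (meanExcess S b (contract w ∘ₗ H)) := by
        rw [← Fintype.expect_const (ι := Fin k → ZMod 2)
          (𝔼 h : BinaryLinearMap u k, truncatedRatio (2 * η + 2 * η ^ 2) (meanExcess S b h))]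
        exact expect_congr rfl fun w _ => (expect_contract_comp w fun h =>
          truncatedRatio (2 * η + 2 * η ^ 2) (meanExcess S b h)).symm
    _ ≤ _ := by
        rw [expect_comm]
        exact expect_le_expect fun H _ => expect_truncatedRatio_contract_le S hb hη H

/-- The scale of the potential at output dimension `k`. -/
noncomputable def excessScale (s : ℝ) (k : ℕ) : ℝ := (Real.exp (s / 2 ^ k) - 1) / 2

/-- The quantity `1 + 2 * η` equals `exp (s / 2 ^ k)`, which squares when `k` drops by one. -/
lemma excessScale_eq_succ (s : ℝ) (k : ℕ) :
    excessScale s k = 2 * excessScale s (k + 1) + 2 * excessScale s (k + 1) ^ 2 := by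
  have : Real.exp (s / 2 ^ k) = Real.exp (s / 2 ^ (k + 1)) ^ 2 := by
    rw [← Real.exp_nat_mul]
    congr 1
    rw [pow_succ]
    field_simp
    norm_num
  rw [excessScale, excessScale, this]
  ring

lemma div_le_excessScale (s : ℝ) (k : ℕ) : s / 2 ^ k / 2 ≤ excessScale s k := by
  have := Real.add_one_le_exp (s / 2 ^ k)
  unfold excessScale
  linarith

lemma excessScale_pos {s : ℝ} (hs : 0 < s) (k : ℕ) : 0 < excessScale s k :=
  lt_of_lt_of_le (by positivity) (div_le_excessScale s k)

lemma expect_truncatedRatio_le_add (hb : 1 ≤ b) {s : ℝ} (hs : 0 < s) (l j : ℕ) :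
    𝔼 h : BinaryLinearMap u l, truncatedRatio (excessScale s l) (meanExcess S b h) ≤
      𝔼 H : BinaryLinearMap u (l + j),
        truncatedRatio (excessScale s (l + j)) (meanExcess S b H) := by
  induction j with
  | zero => exact le_rfl
  | succ j ih =>
    refine ih.trans ?_
    rw [excessScale_eq_succ s (l + j)]
    exact expect_truncatedRatio_le_succ S hb (excessScale_pos hs _) _

/-! ### High dimension: injectivity on `S` -/

lemma expect_apply_eq_zero {x : Fin u → ZMod 2} (hx : x ≠ 0) (k : ℕ) :
    𝔼 H : BinaryLinearMap u k, (if H x = 0 then 1 else 0 : ℝ) = 1 / 2 ^ k := by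
  let φ : BinaryLinearMap u k →+ (Fin k → ZMod 2) :=
    { toFun := fun H => H x
      map_zero' := rfl
      map_add' := fun a b => rfl }
  have hφ : Function.Surjective φ := by
    intro y
    obtain ⟨f, hf⟩ := Module.Projective.exists_dual_ne_zero (ZMod 2) hx
    refine ⟨(f x)⁻¹ • f.smulRight y, ?_⟩
    change (f x)⁻¹ • f x • y = y
    rw [smul_smul, inv_mul_cancel₀ hf, one_smul]
  refine (expect_comp_addMonoidHom φ hφ fun y => (if y = 0 then 1 else 0 : ℝ)).trans ?_
  rw [Fintype.expect_eq_sum_div_card]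
  simp

open Classical in
-- Union bound over ordered pairs of distinct keys, each colliding with probability `1 / 2 ^ k`.
lemma expect_not_injOn_le (k : ℕ) :
    𝔼 H : BinaryLinearMap u k, (if Set.InjOn H S then 0 else 1 : ℝ) ≤ (#S : ℝ) ^ 2 / 2 ^ k := by
  calc 𝔼 H : BinaryLinearMap u k, (if Set.InjOn H S then 0 else 1 : ℝ)
      ≤ 𝔼 H : BinaryLinearMap u k,
        ∑ p ∈ S.offDiag, (if H (p.1 - p.2) = 0 then 1 else 0 : ℝ) := by
        refine expect_le_expect fun H _ => ?_
        have h0 : ∀ p ∈ S.offDiag, (0 : ℝ) ≤ if H (p.1 - p.2) = 0 then 1 else 0 := by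
          intro p _
          split_ifs <;> norm_num
        split_ifs with hinj
        · exact sum_nonneg h0
        · simp only [Set.InjOn, not_forall] at hinj
          obtain ⟨x, hx, y, hy, hxy, hne⟩ := hinj
          have := single_le_sum h0 (mem_offDiag.2 ⟨hx, hy, hne⟩ : (x, y) ∈ S.offDiag)
          simpa [hxy] using this
    _ = ∑ p ∈ S.offDiag, 𝔼 H : BinaryLinearMap u k,
          (if H (p.1 - p.2) = 0 then 1 else 0 : ℝ) := expect_sum_comm _ _ _
    _ = ∑ p ∈ S.offDiag, (1 / 2 ^ k : ℝ) := sum_congr rfl fun p hp =>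
        expect_apply_eq_zero (sub_ne_zero.2 (mem_offDiag.1 hp).2.2) k
    _ ≤ _ := by
        rw [sum_const, nsmul_eq_mul, mul_one_div]
        gcongr
        rw [offDiag_card]
        exact_mod_cast (Nat.sub_le _ _).trans (sq _).ge

lemma meanExcess_of_injOn {k : ℕ} (H : BinaryLinearMap u k) (hH : Set.InjOn H S) :
    meanExcess S b H = (b - 1) * #S / 2 ^ k := by
  have h1 : ∀ y, b ^ binLoad S H y - 1 = (b - 1) * binLoad S H y := by
    intro y
    have : binLoad S H y ≤ 1 := card_le_one.2 fun x hx x' hx' => by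
      rw [mem_filter] at hx hx'
      exact hH hx.1 hx'.1 (hx.2.trans hx'.2.symm)
    interval_cases binLoad S H y <;> simp
  have h2 : ∑ y, binLoad S H y = #S := by
    simpa [binLoad] using sum_card_fiberwise_eq_card_filter S univ H
  rw [meanExcess, Fintype.expect_eq_sum_div_card, sum_congr rfl fun y _ => h1 y, ← mul_sum,
    ← Nat.cast_sum, h2]
  simp

/-- The second-moment type bound for the logarithm of the average exponential load. -/
lemma expect_truncatedRatio_le_sq (hb : 1 ≤ b) {s : ℝ} (hs : 0 < s) (l : ℕ) :
    𝔼 h : BinaryLinearMap u l, truncatedRatio (excessScale s l) (meanExcess S b h) ≤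
      (2 * (b - 1) * #S / s) ^ 2 := by
  classical
  have bound : ∀ j : ℕ,
      𝔼 h : BinaryLinearMap u l, truncatedRatio (excessScale s l) (meanExcess S b h) ≤
        (#S : ℝ) ^ 2 / 2 ^ (l + j) + (2 * (b - 1) * #S / s) ^ 2 := by
    intro j
    refine (expect_truncatedRatio_le_add S hb hs l j).trans ?_
    have pt : ∀ H : BinaryLinearMap u (l + j),
        truncatedRatio (excessScale s (l + j)) (meanExcess S b H) ≤
          (if Set.InjOn H S then 0 else 1) + (2 * (b - 1) * #S / s) ^ 2 := by
      intro H
      split_ifs with hH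
      · rw [zero_add]
        have hpos := excessScale_pos hs (l + j)
        refine (truncatedRatio_le_sq hpos (meanExcess_nonneg S hb H)).trans ?_
        rw [meanExcess_of_injOn S H hH]
        have hb' : 0 ≤ b - 1 := sub_nonneg.2 hb
        refine pow_le_pow_left₀ (by positivity) ?_ 2
        calc (b - 1) * #S / 2 ^ (l + j) / excessScale s (l + j)
            ≤ (b - 1) * #S / 2 ^ (l + j) / (s / 2 ^ (l + j) / 2) := by
              gcongr
              exact div_le_excessScale s _
          _ = _ := by field_simp
      · have := truncatedRatio_le_half (excessScale s (l + j)) (meanExcess S b H)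
        nlinarith [sq_nonneg (2 * (b - 1) * #S / s)]
    refine (expect_le_expect fun H _ => pt H).trans ?_
    rw [expect_add_distrib, Fintype.expect_const]
    gcongr
    exact expect_not_injOn_le S _
  -- The extra dimension `j` is auxiliary; letting it tend to infinity removes the collision term.
  have hlim : Filter.Tendsto
      (fun j : ℕ => (#S : ℝ) ^ 2 / 2 ^ (l + j) + (2 * (b - 1) * #S / s) ^ 2)
      Filter.atTop (nhds (0 + (2 * (b - 1) * #S / s) ^ 2)) := by
    refine Filter.Tendsto.add_const _ ?_
    refine Filter.Tendsto.div_atTop tendsto_const_nhds ?_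
    exact (tendsto_pow_atTop_atTop_of_one_lt one_lt_two).comp
      (Filter.tendsto_atTop_mono (fun j => Nat.le_add_left j l) Filter.tendsto_id)
  rw [zero_add] at hlim
  exact ge_of_tendsto hlim (Filter.Eventually.of_forall bound)

/-! ### Tail bound and choice of parameters -/

open Classical in
lemma randomMapProb_eq_expect (l : ℕ) (A : Set (BinaryLinearMap u l)) :
    randomMapProb u l A = 𝔼 h, (if h ∈ A then 1 else 0 : ℝ) := by
  rw [randomMapProb, PMF.toOuterMeasure_uniformOfFintype_apply, Fintype.expect_eq_sum_div_card,
    ENNReal.toReal_div, sum_boole]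
  simp [Fintype.card_subtype]

/-- Tail bound for the mean excess of a uniformly random linear map. -/
lemma randomMapProb_excessScale_le (hb : 1 ≤ b) {s : ℝ} (hs : 0 < s) (l : ℕ)
    (A : Set (BinaryLinearMap u l)) (hA : ∀ h ∈ A, excessScale s l ≤ meanExcess S b h) :
    randomMapProb u l A ≤ 8 * ((b - 1) * #S / s) ^ 2 := by
  classical
  rw [randomMapProb_eq_expect]
  -- Markov: on `A` the potential sits at its cap `1 / 2`.
  calc 𝔼 h, (if h ∈ A then 1 else 0 : ℝ)
      ≤ 𝔼 h : BinaryLinearMap u l,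
        truncatedRatio (excessScale s l) (meanExcess S b h) * 2 := by
        refine expect_le_expect fun h _ => ?_
        split_ifs with hh
        · rw [truncatedRatio_eq_half (excessScale_pos hs l) (hA h hh)]
          norm_num
        · exact mul_nonneg (truncatedRatio_nonneg (excessScale_pos hs l)
            (meanExcess_nonneg S hb h)) zero_le_two
    _ ≤ (2 * (b - 1) * #S / s) ^ 2 * 2 := by
        rw [← expect_mul]
        gcongr
        exact expect_truncatedRatio_le_sq S hb hs l
    _ = _ := by ring

lemma le_meanExcess_of_le_maxLoad (hb : 1 ≤ b) {l : ℕ} (h : BinaryLinearMap u l) {x : ℝ}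
    (hx : x ≤ maxLoad S h) : (b ^ x - 1) / 2 ^ l ≤ meanExcess S b h := by
  obtain ⟨y, -, hy⟩ := exists_mem_eq_sup univ univ_nonempty (fun y => binLoad S h y)
  have hy' : x ≤ binLoad S h y := by rwa [maxLoad, hy] at hx
  rw [meanExcess, Fintype.expect_eq_sum_div_card]
  have hcard : (Fintype.card (Fin l → ZMod 2) : ℝ) = 2 ^ l := by simp
  rw [hcard]
  gcongr
  calc b ^ x - 1 ≤ b ^ (binLoad S h y : ℝ) - 1 := by gcongr
    _ = b ^ binLoad S h y - 1 := by rw [Real.rpow_natCast]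
    _ ≤ _ := single_le_sum (f := fun y => b ^ binLoad S h y - 1)
        (fun y _ => excess_nonneg hb _) (mem_univ y)

end Excess

theorem corollaryC3 :
    ∃ C D : ℝ, 0 < C ∧ 0 < D ∧
      ∀ (l u m n : ℕ) (S : Finset (Fin u → ZMod 2)),
        n = 2 ^ l → S.card = m → 0 < m →
        ∀ lam t : ℝ, lam = (m : ℝ) / (n : ℝ) →
          0 < t → t * Real.log (t / (Real.exp 1 * lam)) = Real.log (n : ℝ) →
          ∀ R : ℝ, 1 < R → D ≤ R * (t / lam) ^ (1 - 1 / R) →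
            randomMapProb u l {h | R * t ≤ (maxLoad S h : ℝ)} ≤
              C / R ^ 2 * (lam / t) ^ (2 - 2 / R) := by
  refine ⟨8 * Real.exp 1 ^ 2, 1, by positivity, one_pos, ?_⟩
  intro l u m n S hn hm hm0 lam t hlam ht hlog R hR _
  have hn1 : (1 : ℝ) ≤ n := by rw [hn]; exact_mod_cast Nat.one_le_two_pow
  have hn0 : (0 : ℝ) < n := by linarith
  have hm0' : (0 : ℝ) < m := by exact_mod_cast hm0
  have hlam0 : 0 < lam := by rw [hlam]; positivity
  have hR0 : 0 < R := by linarith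
  have hle : 1 ≤ t / (Real.exp 1 * lam) := by
    by_contra! hlt
    have h1 := Real.log_neg (by positivity) hlt
    have h2 := Real.log_nonneg hn1
    nlinarith
  have hq : 1 ≤ t / lam := by
    refine hle.trans ?_
    gcongr
    nlinarith [Real.add_one_le_exp (1 : ℝ)]
  have hq0 : 0 < t / lam := by positivity
  -- The power of `t / lam` makes `b ^ (R * t)` absorb the factor `n` lost by averaging over bins;
  -- the factor `exp 1` makes it also exceed `exp (R * t)`, the size of the scale when `s = R * t *
  -- 2 ^ l`.
  set b : ℝ := (t / lam) ^ (1 / R) * Real.exp 1 with hb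
  have hb0 : 0 < b := by positivity
  have hb1 : 1 ≤ b := one_le_mul_of_one_le_of_one_le
    (Real.one_le_rpow hq (by positivity)) (Real.one_le_exp zero_le_one)
  have hbpow : b ^ (R * t) = n * Real.exp (t + R * t) := by
    have hlogq : t * Real.log (t / lam) = Real.log n + t := by
      rw [← hlog, mul_comm (Real.exp 1), ← div_div, Real.log_div hq0.ne' (Real.exp_pos 1).ne',
        Real.log_exp]
      ring
    rw [Real.rpow_def_of_pos hb0, hb, Real.log_mul (by positivity) (Real.exp_pos 1).ne',
      Real.log_exp, Real.log_rpow hq0]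
    nth_rewrite 1 [← Real.exp_log hn0]
    rw [← Real.exp_add]
    congr 1
    calc (1 / R * Real.log (t / lam) + 1) * (R * t) = t * Real.log (t / lam) + R * t := by
          field_simp
      _ = _ := by rw [hlogq]; ring
  have hn' : (2 : ℝ) ^ l = n := by rw [hn]; push_cast; rfl
  have hs : 0 < R * t * 2 ^ l := by positivity
  refine (randomMapProb_excessScale_le S hb1 hs l _ fun h hh => ?_).trans ?_
  · refine le_trans ?_ (le_meanExcess_of_le_maxLoad S hb1 h hh)
    rw [hbpow, excessScale, mul_div_cancel_right₀ _ (by positivity), hn', sub_div _ 1 (n : ℝ),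
      mul_div_cancel_left₀ _ hn0.ne']
    have h1 : 1 / (n : ℝ) ≤ 1 := (div_le_one hn0).2 hn1
    have h2 : Real.exp (R * t) ≤ Real.exp (t + R * t) := Real.exp_le_exp.2 (by linarith)
    have h3 : 1 ≤ Real.exp (R * t) := Real.one_le_exp (by positivity)
    linarith
  · have h1 : (b - 1) * #S / (R * t * 2 ^ l) ≤
        Real.exp 1 / R * (lam / t) ^ (1 - 1 / R) := by
      calc (b - 1) * #S / (R * t * 2 ^ l) ≤ b * #S / (R * t * 2 ^ l) := by gcongr; linarith
        _ = Real.exp 1 / R * ((t / lam) ^ (1 / R) * (lam / t)) := by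
            rw [hb, hm, hn', hlam]
            field_simp
        _ = _ := by
            rw [← inv_div lam t, Real.inv_rpow (by positivity), Real.rpow_sub (by positivity),
              Real.rpow_one]
            ring
    have h0 : 0 ≤ (b - 1) * #S / (R * t * 2 ^ l) := by
      have := sub_nonneg.2 hb1
      positivity
    calc 8 * ((b - 1) * #S / (R * t * 2 ^ l)) ^ 2
        ≤ 8 * (Real.exp 1 / R * (lam / t) ^ (1 - 1 / R)) ^ 2 := by gcongr
      _ = _ := by
          rw [mul_pow, ← Real.rpow_mul_natCast (by positivity), div_pow]
          have : (1 - 1 / R) * ((2 : ℕ) : ℝ) = 2 - 2 / R := by push_cast; ring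
          rw [this]
          ring
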